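/- Let $\mathbf{dJo}=\mathrm{PGL}(2,\mathbb{C}(x))\rtimes \mathrm{PGL}(2,\mathbb{C})$ be the de Jonquières group, where $h\in\mathrm{PGL}(2,\mathbb{C})=\mathrm{Aut}(\mathbb{P}^1)$ acts on $\mathbb{C}(x)=\mathbb{C}(\mathbb{P}^1)$ by $F\mapsto F\circ h^{-1}$ and on $\mathrm{PGL}(2,\mathbb{C}(x))$ by acting on the entries of matrices; regard $\mathrm{PGL}(2,\mathbb{C}(x))$ and $\mathrm{PGL}(2,\mathbb{C})$ as subgroups of $\mathbf{dJo}$ in the standard way. Let $G\subset\mathbf{dJo}$ be any subgroup (for instance an algebraic one), let $H\subset\mathrm{PGL}(2,\mathbb{C})$ be the image of $G$ under the projection $\mathbf{dJo}\to\mathrm{PGL}(2,\mathbb{C})$ and let $G'=G\cap\mathrm{PGL}(2,\mathbb{C}(x))$ be the kernel of $G\to H$. Assume that $H$ is finite. 1. If $G'=\{1\}$, then there is $g\in\mathbf{dJo}$ with $gGg^{-1}=H$. 2. If $G'$ is generated by an element $\sigma\in\mathrm{PGL}(2,\mathbb{C}(x))$ of order $2$ whose determinant in $\mathbb{C}(x)^*/(\mathbb{C}(x)^*)^2$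 is nontrivial, then there is a subgroup $V\subset\mathrm{PGL}(2,\mathbb{C}(x))$, isomorphic to $(\mathbb{Z}/2\mathbb{Z})^2$ and containing $G'$, such that $G$ normalizes $V$, i.e. $gVg^{-1}=V$ for all $g\in G$. -/

import Mathlib

open scoped MatrixGroups

noncomputable section

namespace DeJonquieres

/-- The Möbius fraction `(a x + b) / (c x + d)` in `ℂ(x)` attached to an invertible complex
matrix `[[a, b], [c, d]]`. -/
def moebius (g : GL (Fin 2) ℂ) : RatFunc ℂ :=
  (RatFunc.C (g 0 0) * RatFunc.X + RatFunc.C (g 0 1)) /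
    (RatFunc.C (g 1 0) * RatFunc.X + RatFunc.C (g 1 1))

/-- A linear form `a x + b` with `(a, b) ≠ (0, 0)` is a nonzero rational function. -/
theorem linear_ne_zero {a b : ℂ} (h : ¬ (a = 0 ∧ b = 0)) :
    RatFunc.C a * RatFunc.X + RatFunc.C b ≠ (0 : RatFunc ℂ) := by
  intro h0
  have h1 : algebraMap (Polynomial ℂ) (RatFunc ℂ)
      (Polynomial.C a * Polynomial.X + Polynomial.C b) = 0 := by
    simpa [RatFunc.algebraMap_X] using h0
  have h2 := (map_eq_zero_iff _ (RatFunc.algebraMap_injective ℂ)).1 h1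
  apply h
  constructor
  · simpa using congrArg (fun p => Polynomial.coeff p 1) h2
  · simpa using congrArg (fun p => Polynomial.coeff p 0) h2

theorem det_entries_ne_zero (g : GL (Fin 2) ℂ) : g 0 0 * g 1 1 - g 0 1 * g 1 0 ≠ 0 := by
  have h := g.det.ne_zero
  rwa [Matrix.GeneralLinearGroup.val_det_apply, Matrix.det_fin_two] at h

theorem denom_moebius_ne_zero (g : GL (Fin 2) ℂ) :
    RatFunc.C (g 1 0) * RatFunc.X + RatFunc.C (g 1 1) ≠ (0 : RatFunc ℂ) := by
  apply linear_ne_zero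
  rintro ⟨h1, h2⟩
  apply det_entries_ne_zero g
  rw [h1, h2]
  ring

theorem moebius_ne_C (g : GL (Fin 2) ℂ) : ¬ ∃ c, moebius g = RatFunc.C c := by
  rintro ⟨c, hc⟩
  rw [moebius, div_eq_iff (denom_moebius_ne_zero g)] at hc
  have h1 : RatFunc.C (g 0 0 - c * g 1 0) * RatFunc.X + RatFunc.C (g 0 1 - c * g 1 1)
      = (0 : RatFunc ℂ) := by
    simp only [map_sub, map_mul]
    linear_combination hc
  have h2 : g 0 0 - c * g 1 0 = 0 ∧ g 0 1 - c * g 1 1 = 0 := by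
    by_contra h
    exact linear_ne_zero h h1
  apply det_entries_ne_zero g
  linear_combination g 1 1 * h2.1 - g 1 0 * h2.2

/-- Substitution `F(x) ↦ F((a x + b) / (c x + d))`, as a `ℂ`-algebra endomorphism of `ℂ(x)`. -/
def subst (g : GL (Fin 2) ℂ) : RatFunc ℂ →ₐ[ℂ] RatFunc ℂ :=
  (IntermediateField.val _).comp
    (RatFunc.algEquivOfTranscendental (moebius g)
      (RatFunc.transcendental_of_ne_C _ (moebius_ne_C g))).toAlgHom

@[simp]
theorem subst_X (g : GL (Fin 2) ℂ) : subst g RatFunc.X = moebius g := by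
  simp [subst]

@[simp]
theorem subst_C (g : GL (Fin 2) ℂ) (c : ℂ) : subst g (RatFunc.C c) = RatFunc.C c :=
  (subst g).commutes c

/-- Two `ℂ`-algebra endomorphisms of `ℂ(x)` that agree at `x` are equal. -/
theorem algHom_ext_X {f g : RatFunc ℂ →ₐ[ℂ] RatFunc ℂ} (h : f RatFunc.X = g RatFunc.X) :
    f = g := by
  have hp : ∀ p : Polynomial ℂ, f (algebraMap _ _ p) = g (algebraMap _ _ p) := by
    intro p
    rw [← RatFunc.aeval_X_left_eq_algebraMap, ← Polynomial.aeval_algHom_apply,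
      ← Polynomial.aeval_algHom_apply, h]
  ext u
  rw [← RatFunc.num_div_denom u, map_div₀, map_div₀, hp, hp]

theorem subst_one : subst 1 = AlgHom.id ℂ (RatFunc ℂ) := by
  apply algHom_ext_X
  simp [moebius]

theorem subst_mul (g h : GL (Fin 2) ℂ) : subst (g * h) = (subst h).comp (subst g) := by
  apply algHom_ext_X
  have e : ∀ i j, (g * h) i j = g i 0 * h 0 j + g i 1 * h 1 j := by
    intro i j
    simp [Matrix.mul_apply, Fin.sum_univ_two]
  have hgh := denom_moebius_ne_zero (g * h)
  have hh := denom_moebius_ne_zero h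
  simp only [AlgHom.comp_apply, subst_X]
  conv_rhs => rw [moebius]
  simp only [map_div₀, map_add, map_mul, subst_X, subst_C]
  rw [moebius]
  simp only [e, map_add, map_mul] at hgh ⊢
  have hd : RatFunc.C (g 1 0) * moebius h + RatFunc.C (g 1 1) ≠ 0 := by
    intro h0
    apply hgh
    have h1 : moebius h * (RatFunc.C (h 1 0) * RatFunc.X + RatFunc.C (h 1 1)) =
        RatFunc.C (h 0 0) * RatFunc.X + RatFunc.C (h 0 1) := div_mul_cancel₀ _ hh
    linear_combination (RatFunc.C (h 1 0) * RatFunc.X + RatFunc.C (h 1 1)) * h0 -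
      RatFunc.C (g 1 0) * h1
  have h1 : moebius h * (RatFunc.C (h 1 0) * RatFunc.X + RatFunc.C (h 1 1)) =
      RatFunc.C (h 0 0) * RatFunc.X + RatFunc.C (h 0 1) := div_mul_cancel₀ _ hh
  rw [div_eq_div_iff hgh hd]
  linear_combination (RatFunc.C (g 0 1) * RatFunc.C (g 1 0) -
    RatFunc.C (g 0 0) * RatFunc.C (g 1 1)) * h1

/-- The left action of `GL(2, ℂ)` on the function field `ℂ(x)` of the projective line,
`g · F = F ∘ g⁻¹`. -/
def glAction : GL (Fin 2) ℂ →* (RatFunc ℂ ≃ₐ[ℂ] RatFunc ℂ) where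
  toFun g := AlgEquiv.ofAlgHom (subst g⁻¹) (subst g)
    (by rw [← subst_mul, mul_inv_cancel, subst_one])
    (by rw [← subst_mul, inv_mul_cancel, subst_one])
  map_one' := by
    ext u
    simp [subst_one]
  map_mul' g h := by
    ext u
    simp [subst_mul]

theorem glAction_scalar :
    glAction.comp (Matrix.GeneralLinearGroup.scalar (Fin 2)) = 1 := by
  ext u F
  have h : subst (Matrix.GeneralLinearGroup.scalar (Fin 2) u)⁻¹ = AlgHom.id ℂ (RatFunc ℂ) := by
    apply algHom_ext_X
    rw [← map_inv, subst_X, moebius]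
    generalize u⁻¹ = v
    have hv : RatFunc.C (v : ℂ) ≠ (0 : RatFunc ℂ) := by
      simp
    simp [Matrix.diagonal, hv]
  simpa [glAction] using DFunLike.congr_fun h F

/-- The left action of `PGL(2, ℂ) = Aut(ℙ¹)` on `ℂ(x) = ℂ(ℙ¹)`, `h · F = F ∘ h⁻¹`. -/
def pglAction : PGL(2, ℂ) →* (RatFunc ℂ ≃ₐ[ℂ] RatFunc ℂ) :=
  Matrix.ProjGenLinGroup.lift glAction glAction_scalar

/-- The automorphism of `PGL(2, R)` obtained by applying an algebra automorphism of `R` to the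
entries of matrices. -/
def pglMap {k R : Type*} [CommRing k] [CommRing R] [Algebra k R] :
    (R ≃ₐ[k] R) →* MulAut PGL(2, R) where
  toFun e := MonoidHom.toMulEquiv
    (Matrix.ProjGenLinGroup.map (e : R →+* R)) (Matrix.ProjGenLinGroup.map (e.symm : R →+* R))
    (by
      rw [← Matrix.ProjGenLinGroup.map_comp]
      convert! Matrix.ProjGenLinGroup.map_id
      ext; simp)
    (by
      rw [← Matrix.ProjGenLinGroup.map_comp]
      convert! Matrix.ProjGenLinGroup.map_id
      ext; simp)
  map_one' := by
    ext A
    exact DFunLike.congr_fun (Matrix.ProjGenLinGroup.map_id (n := Fin 2) (R := R)) A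
  map_mul' e f := by
    ext A
    exact DFunLike.congr_fun
      (Matrix.ProjGenLinGroup.map_comp (n := Fin 2) (f : R →+* R) (e : R →+* R)) A

/-- The action of `PGL(2, ℂ)` on `PGL(2, ℂ(x))` through its action on `ℂ(x)`. -/
def baseAction : PGL(2, ℂ) →* MulAut PGL(2, RatFunc ℂ) :=
  pglMap.comp pglAction

/-- The de Jonquières group `PGL(2, ℂ(x)) ⋊ PGL(2, ℂ)`. The pair `(B, h)` is the birational map
`(x, y) ⇢ (h(x), B_{h(x)}(y))`, i.e. first `h` on the base and then `B` on the fibres. -/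
abbrev DJo : Type := PGL(2, RatFunc ℂ) ⋊[baseAction] PGL(2, ℂ)

/-- The inclusion `PGL(2, ℂ(x)) ⊂ dJo`. -/
abbrev inFibre : PGL(2, RatFunc ℂ) →* DJo := SemidirectProduct.inl

/-- The standard inclusion `PGL(2, ℂ) ⊂ dJo`. -/
abbrev inBase : PGL(2, ℂ) →* DJo := SemidirectProduct.inr

/-- The action of `dJo` on the base of the fibration. -/
abbrev toBase : DJo →* PGL(2, ℂ) := SemidirectProduct.rightHom

/-- The image `H` of the action of `G` on the base of the fibration. -/
def baseImage (G : Subgroup DJo) : Subgroup PGL(2, ℂ) := G.map toBase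

/-- The kernel `G'` of the action of `G` on the base of the fibration, as a subgroup of `dJo`. -/
def fibreKernel (G : Subgroup DJo) : Subgroup DJo := G ⊓ toBase.ker

/-- The determinant `PGL(2, K) → Kˣ / (Kˣ)²`. -/
def pglDet (K : Type*) [Field K] : PGL(2, K) →* Kˣ ⧸ (powMonoidHom 2 : Kˣ →* Kˣ).range :=
  Matrix.ProjGenLinGroup.lift
    ((QuotientGroup.mk' _).comp Matrix.GeneralLinearGroup.det) (by
      ext u
      simp only [MonoidHom.comp_apply, MonoidHom.one_apply, QuotientGroup.mk'_apply,
        QuotientGroup.eq_one_iff]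
      refine ⟨u, ?_⟩
      ext
      simp [pow_two])

end DeJonquieres

end

/-! The `PGL(2, ℂ(x))`-components of the elements of `G` form a cocycle for the action of `G` on `K
= ℂ(x)`, and this action factors through a finite group `Γ` because `H` is finite. Everything rests
on the triviality of `H¹(Γ, PGL(2, K))`, proved by hand in `exists_coboundary_of_pgl_cocycle`.

By Lüroth, the fixed field `k` of `Γ` is `ℂ` or isomorphic to `ℂ(t)`, and Legendre descent gives
every ternary quadratic form over `k` a nontrivial zero. A cocycle twists the action of `Γ` on
traceless matrices. By Galois descent the fixed ones span, and `tr(N²)` is a ternary form over `k`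
on the span over `k` of a `K`-basis of fixed matrices. A zero of it is a fixed nilpotent matrix,
which reduces the cocycle to a unipotent group `(K, +)`, where averaging splits it.

If `G' = 1`, the cocycle descends to `Γ`, and the element splitting it conjugates `G` to `H`.

If `G' = ⟨σ⟩` with `σ` the class of `M`, the cocycle need not descend. But `G` centralises `σ`,
hence acts semilinearly on the plane of traceless matrices orthogonal to `M`. These anticommute with
`M`, so `G'` acts on the plane by `±1`; the projectivised action does descend, and `G` fixes a line
(`exists_fixed_line`). Since `-det M` is not a square, a generator `T` of this line is invertible.
Its class is an involution commuting with `σ` and with `G`, and together with `σ` it generates `V`.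
-/

section TernaryForms

/-! ### Isotropy of ternary quadratic forms (Legendre, Tsen, Lüroth) -/

open Polynomial
/-- Over `F`, all ternary forms `x² - a y² - b z²` are isotropic. -/
def TernaryIsotropic (F : Type*) [CommRing F] : Prop :=
  ∀ a b : F, ∃ x y z : F, (x ≠ 0 ∨ y ≠ 0 ∨ z ≠ 0) ∧ x ^ 2 = a * y ^ 2 + b * z ^ 2

/-- Every polynomial is a square modulo a squarefree polynomial over an algebraically closed
field. -/
theorem exists_sq_sub_dvd_of_squarefree {F : Type*} [Field F] [IsAlgClosed F] (a : F[X])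
    {b : F[X]} (hb : Squarefree b) : ∃ c : F[X], c.degree < b.degree ∧ b ∣ c ^ 2 - a := by
  classical
  have hb0 : b ≠ 0 := hb.ne_zero
  have hnd : b.roots.Nodup := by
    apply nodup_roots
    exact PerfectField.separable_iff_squarefree.2 hb
  have hs : b.Splits := IsAlgClosed.splits b
  choose r hr using fun t : F => IsAlgClosed.exists_pow_nat_eq (a.eval t) (n := 2) (by norm_num)
  -- Interpolate square roots of the values of `a` at the roots of `b`. These roots are simple, so
  -- vanishing of `c ^ 2 - a` at each of them gives divisibility.
  refine ⟨Lagrange.interpolate b.roots.toFinset id r, ?_, ?_⟩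
  · refine (Lagrange.degree_interpolate_lt r (fun _ _ _ _ h => h)).trans_eq ?_
    rw [Multiset.toFinset_card_of_nodup hnd, degree_eq_natDegree hb0, hs.natDegree_eq_card_roots]
  · by_cases h0 : Lagrange.interpolate b.roots.toFinset id r ^ 2 - a = 0
    · rw [h0]; exact dvd_zero b
    generalize hc : Lagrange.interpolate b.roots.toFinset id r = c at h0 ⊢
    rw [hs.eq_prod_roots]
    refine (Polynomial.C_mul_dvd (leadingCoeff_ne_zero.2 hb0)).2 ?_
    rw [Multiset.prod_X_sub_C_dvd_iff_le_roots h0, Multiset.le_iff_subset hnd]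
    intro t ht
    rw [mem_roots h0, IsRoot.def, eval_sub, eval_pow, ← hr t]
    have := Lagrange.eval_interpolate_at_node r (s := b.roots.toFinset) (v := id)
      (fun _ _ _ _ h => h) (i := t) (by simpa using ht)
    simp only [id, hc] at this
    rw [this, sub_self]

/-- Legendre descent for ternary forms over `F[t]`, `F` algebraically closed. -/
theorem ternaryIsotropic_polynomial (F : Type*) [Field F] [IsAlgClosed F] :
    TernaryIsotropic F[X] := by
  intro a b
  induction h : a.natDegree + b.natDegree using Nat.strong_induction_on generalizing a b with
  | _ n ih =>
  wlog hab : a.natDegree ≤ b.natDegree generalizing a b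
  · obtain ⟨x, y, z, h0, h1⟩ := this b a (by omega) (by omega)
    exact ⟨x, z, y, by tauto, by rw [h1]; ring⟩
  by_cases hb : b.natDegree = 0
  · rw [natDegree_eq_zero] at hb
    obtain ⟨β, rfl⟩ := hb
    obtain ⟨s, hs⟩ := IsAlgClosed.exists_pow_nat_eq β (n := 2) (by norm_num)
    exact ⟨C s, 0, 1, by simp, by rw [← C_pow, hs]; ring⟩
  have hb0 : b ≠ 0 := by rintro rfl; simp at hb
  by_cases hsq : Squarefree b
  · obtain ⟨c, hc, b', hb'⟩ := exists_sq_sub_dvd_of_squarefree a hsq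
    by_cases hb'0 : b' = 0
    · refine ⟨c, 1, 0, by simp, ?_⟩
      rw [hb'0] at hb'
      linear_combination hb'
    have hcd : c.natDegree < b.natDegree := by
      by_cases hc0 : c = 0
      · rw [hc0, natDegree_zero]; omega
      · exact natDegree_lt_natDegree hc0 hc
    -- From `c ^ 2 - a = b * b'` with `deg c < deg b` and `deg a ≤ deg b`, the cofactor `b'` has
    -- smaller degree than `b` and can replace it.
    have hdeg : b.natDegree + b'.natDegree < 2 * b.natDegree := by
      rw [← natDegree_mul hb0 hb'0, ← hb']
      refine (natDegree_sub_le _ _).trans_lt (max_lt ?_ (by omega))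
      rw [natDegree_pow]
      omega
    obtain ⟨x, y, z, h0, h1⟩ := ih _ (by omega) a b' rfl
    by_cases hz : z = 0
    · exact ⟨x, y, 0, by simpa [hz] using h0, by rw [h1, hz]; ring⟩
    -- Multiplicativity of the norm from `√a`: `(c² - a)(x² - a y²) = (c x + a y)² - a (x + c y)²`.
    · refine ⟨c * x + a * y, x + c * y, b' * z, by simp [hz, hb'0], ?_⟩
      linear_combination (c ^ 2 - a) * h1 + b' * z ^ 2 * hb'
  · simp only [Squarefree, not_forall] at hsq
    obtain ⟨p, ⟨q, rfl⟩, hp⟩ := hsq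
    have hp0 : p ≠ 0 := by rintro rfl; simp at hb0
    have hq0 : q ≠ 0 := by rintro rfl; simp at hb0
    have hpd : 0 < p.natDegree := by
      by_contra hh
      exact hp ((isUnit_iff_degree_eq_zero).2
        (by rw [degree_eq_natDegree hp0]; norm_cast; omega))
    have hdeg : (p * p * q).natDegree = p.natDegree + p.natDegree + q.natDegree := by
      rw [natDegree_mul (mul_ne_zero hp0 hp0) hq0, natDegree_mul hp0 hp0]
    obtain ⟨x, y, z, h0, h1⟩ := ih _ (by omega) a q rfl
    refine ⟨p * x, p * y, z, by simpa [hp0] using h0, ?_⟩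
    linear_combination p ^ 2 * h1

/-- The coefficients `a / d` and `a * d` differ by the square `d²`, so clearing denominators only
rescales the variables. -/
theorem TernaryIsotropic.of_isFractionRing {R F : Type*} [CommRing R] [IsDomain R] [Field F]
    [Algebra R F] [IsFractionRing R F] (h : TernaryIsotropic R) : TernaryIsotropic F := by
  intro a b
  obtain ⟨a, d, hd, rfl⟩ := IsFractionRing.div_surjective (A := R) a
  obtain ⟨b, e, he, rfl⟩ := IsFractionRing.div_surjective (A := R) b
  have hd' := IsFractionRing.to_map_ne_zero_of_mem_nonZeroDivisors (K := F) hd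
  have he' := IsFractionRing.to_map_ne_zero_of_mem_nonZeroDivisors (K := F) he
  have hinj := IsFractionRing.injective R F
  obtain ⟨x, y, z, h0, h1⟩ := h (a * d) (b * e)
  refine ⟨algebraMap R F x, algebraMap R F d * algebraMap R F y,
    algebraMap R F e * algebraMap R F z, ?_, ?_⟩
  · simpa [hd', he'] using h0
  · have := congrArg (algebraMap R F) h1
    simp only [map_mul, map_add, map_pow] at this
    rw [this]
    field_simp

theorem TernaryIsotropic.of_ringEquiv {R S : Type*} [CommRing R] [CommRing S] (e : R ≃+* S)
    (h : TernaryIsotropic R) : TernaryIsotropic S := by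
  intro a b
  obtain ⟨x, y, z, h0, h1⟩ := h (e.symm a) (e.symm b)
  refine ⟨e x, e y, e z, by simpa using h0, ?_⟩
  simpa using congrArg e h1

theorem IsAlgClosed.ternaryIsotropic (F : Type*) [Field F] [IsAlgClosed F] :
    TernaryIsotropic F := by
  intro a _
  obtain ⟨s, hs⟩ := IsAlgClosed.exists_pow_nat_eq a (n := 2) (by norm_num)
  exact ⟨s, 1, 0, by simp, by rw [hs]; ring⟩

/-- Tsen's theorem for ternary forms over the subfields of `F(x)`. -/
theorem IntermediateField.ternaryIsotropic {F : Type*} [Field F] [IsAlgClosed F]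
    (E : IntermediateField F (RatFunc F)) : TernaryIsotropic E := by
  by_cases h : E = ⊥
  · exact (IsAlgClosed.ternaryIsotropic F).of_ringEquiv
      ((IntermediateField.botEquiv F (RatFunc F)).symm.trans
        (IntermediateField.equivOfEq h.symm)).toRingEquiv
  · exact ((ternaryIsotropic_polynomial F).of_isFractionRing (F := RatFunc F)).of_ringEquiv
      (RatFunc.Luroth.algEquiv h).toRingEquiv

/-- If all ternary forms `x² - a y² - b z²` over `k` are isotropic, so is every quadratic
form on `k³`. -/
theorem TernaryIsotropic.exists_quadraticForm_eq_zero {k : Type*} [Field k] [NeZero (2 : k)]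
    (h : TernaryIsotropic k) (Q : QuadraticForm k (Fin 3 → k)) : ∃ v ≠ 0, Q v = 0 := by
  have : Invertible (2 : k) := invertibleOfNonzero (NeZero.ne 2)
  -- The dimension is left variable because the diagonalisation of `Q` is indexed by `Fin` of a
  -- `finrank`; only the first three coordinates are used.
  have diag : ∀ n, 3 ≤ n → ∀ w : Fin n → k, ∃ v : Fin n → k, v ≠ 0 ∧
      QuadraticMap.weightedSumSquares k w v = 0 := by
    intro n hn w
    obtain ⟨m, rfl⟩ := Nat.exists_eq_add_of_le' hn
    have key : ∃ x y z : k, (x ≠ 0 ∨ y ≠ 0 ∨ z ≠ 0) ∧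
        w 0 * x ^ 2 + w (Fin.succ 0) * y ^ 2 + w (Fin.succ (Fin.succ 0)) * z ^ 2 = 0 := by
      by_cases h0 : w 0 = 0
      · exact ⟨1, 0, 0, by simp, by rw [h0]; ring⟩
      · obtain ⟨x, y, z, h1, h2⟩ :=
          h (-w (Fin.succ 0) / w 0) (-w (Fin.succ (Fin.succ 0)) / w 0)
        refine ⟨x, y, z, h1, ?_⟩
        rw [h2]
        field_simp
        ring
    obtain ⟨x, y, z, h1, h2⟩ := key
    refine ⟨Fin.cons x (Fin.cons y (Fin.cons z 0)), ?_, ?_⟩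
    · intro hv
      have e0 := congrFun hv 0
      have e1 := congrFun hv (Fin.succ 0)
      have e2 := congrFun hv (Fin.succ (Fin.succ 0))
      simp only [Fin.cons_zero, Fin.cons_succ, Pi.zero_apply] at e0 e1 e2
      simp [e0, e1, e2] at h1
    · simp only [QuadraticMap.weightedSumSquares_apply, Fin.sum_univ_succ, Fin.cons_zero,
        Fin.cons_succ, smul_eq_mul, Pi.zero_apply, mul_zero, Finset.sum_const_zero, add_zero]
      linear_combination h2
  obtain ⟨w, ⟨e⟩⟩ := Q.equivalent_weightedSumSquares
  obtain ⟨v, hv, hw⟩ := diag _ (by simp) w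
  refine ⟨e.symm v, ?_, ?_⟩
  · simpa using hv
  · rw [QuadraticMap.IsometryEquiv.map_app]; exact hw

end TernaryForms

section Cocycles

open Matrix Matrix.ProjGenLinGroup DeJonquieres

/-! ### Galois descent for semilinear actions -/

section Descent

variable {F K V : Type*} [Field F] [Field K] [Algebra F K] [AddCommGroup V] [Module K V]

/-- Galois descent: the fixed vectors of a semilinear action of a finite group of field
automorphisms span the whole space. -/
theorem span_fixed_eq_top_of_semilinear {Γ : Subgroup (K ≃ₐ[F] K)} [Finite Γ]
    (Φ : Γ → V →+ V) (h_one : ∀ v, Φ 1 v = v) (h_mul : ∀ γ δ v, Φ (γ * δ) v = Φ γ (Φ δ v))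
    (h_smul : ∀ (γ : Γ) (a : K) v, Φ γ (a • v) = (γ : K ≃ₐ[F] K) a • Φ γ v) :
    Submodule.span K {v | ∀ γ, Φ γ v = v} = ⊤ := by
  have := Fintype.ofFinite Γ
  by_contra hne
  obtain ⟨f, hf, hle⟩ := Submodule.exists_le_ker_of_lt_top _ (lt_top_iff_ne_top.2 hne)
  apply hf
  ext v
  have hinj : Function.Injective fun γ : Γ => ((γ : K ≃ₐ[F] K) : K →* K) := by
    intro γ δ h
    ext a
    exact DFunLike.congr_fun h a
  have hli := (linearIndependent_monoidHom K K).comp _ hinj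
  rw [Fintype.linearIndependent_iff] at hli
  -- The sum of `Φ γ (a • v)` over `γ` is fixed, so `f` kills it. This is a linear relation between
  -- the automorphisms, evaluated at `a`, and Dedekind independence forces `f v = 0`.
  have h0 := hli (fun γ => f (Φ γ v)) (by
    ext a
    have hfix : (∑ γ, Φ γ (a • v)) ∈ {v | ∀ γ, Φ γ v = v} := by
      intro δ
      simp only [map_sum, ← h_mul]
      exact Fintype.sum_equiv (Equiv.mulLeft δ) _ _ fun _ => rfl
    have := hle (Submodule.subset_span hfix)
    simpa [h_smul, mul_comm] using this) 1
  simpa [h_one] using h0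

end Descent

/-! ### Twisted semilinear actions on 2 × 2 matrices -/

section Twist

variable {F K : Type*} [Field F] [Field K] [Algebra F K]

/-- The semilinear ring endomorphism `N ↦ B e(N) B⁻¹` of the matrix algebra. -/
def twist (B : GL (Fin 2) K) (e : K ≃ₐ[F] K) :
    Matrix (Fin 2) (Fin 2) K →+* Matrix (Fin 2) (Fin 2) K where
  toFun N := B.val * N.map e * (B⁻¹).val
  map_one' := by simp [Matrix.map_one]
  map_zero' := by simp
  map_add' M N := by simp [Matrix.map_add, mul_add, add_mul]
  map_mul' M N := by
    have h : (M * N).map e = M.map e * N.map e := Matrix.map_mul (f := (e : K →+* K))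
    simp only [h, mul_assoc, Units.inv_mul_cancel_left]

theorem twist_apply (B : GL (Fin 2) K) (e : K ≃ₐ[F] K) (N : Matrix (Fin 2) (Fin 2) K) :
    twist B e N = B.val * N.map e * (B⁻¹).val := rfl

theorem twist_smul (B : GL (Fin 2) K) (e : K ≃ₐ[F] K) (a : K) (N : Matrix (Fin 2) (Fin 2) K) :
    twist B e (a • N) = e a • twist B e N := by
  have h : (a • N).map e = e a • N.map e := by ext; simp
  simp [twist_apply, h]

theorem twist_injective (B : GL (Fin 2) K) (e : K ≃ₐ[F] K) : Function.Injective (twist B e) :=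
  RingHom.injective _

theorem trace_twist (B : GL (Fin 2) K) (e : K ≃ₐ[F] K) (N : Matrix (Fin 2) (Fin 2) K) :
    (twist B e N).trace = e N.trace := by
  rw [twist_apply, Matrix.trace_mul_comm, Units.inv_mul_cancel_left]
  simp [Matrix.trace]

theorem twist_twist (B B' : GL (Fin 2) K) (e e' : K ≃ₐ[F] K) (N : Matrix (Fin 2) (Fin 2) K) :
    twist B e (twist B' e' N) =
      twist (B * GeneralLinearGroup.map (e : K →+* K) B') (e * e') N := by
  have h : (B'.val * N.map e' * (B'⁻¹).val).map e =
      B'.val.map e * (N.map e').map e * (B'⁻¹).val.map e := by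
    rw [← RingHom.coe_coe e, Matrix.map_mul, Matrix.map_mul]
  have h1 : N.map (e * e') = (N.map e').map e := by ext; simp
  have h2 : (B'⁻¹).val.map e = ((GeneralLinearGroup.map (e : K →+* K) B')⁻¹).val := by
    rw [← GeneralLinearGroup.map_inv]; rfl
  have h3 : B'.val.map e = (GeneralLinearGroup.map (e : K →+* K) B').val := rfl
  rw [twist_apply, twist_apply, twist_apply, h, h1, h2, h3, _root_.mul_inv_rev, Units.val_mul,
    Units.val_mul]
  simp only [mul_assoc]

/-- Scalars cancel under conjugation. Hence lifts of a `PGL`-cocycle give a genuine action on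
matrices, although they satisfy the cocycle relation only up to scalars. -/
theorem twist_congr {B B' : GL (Fin 2) K} (h : mk B = mk B') (e : K ≃ₐ[F] K) :
    twist B e = twist B' e := by
  obtain ⟨u, rfl⟩ := mk_eq_mk_iff.1 h
  ext1 N
  have h1 : B * GeneralLinearGroup.scalar (Fin 2) u = GeneralLinearGroup.scalar (Fin 2) u * B :=
    (GeneralLinearGroup.scalar_commute u B).symm
  rw [twist_apply, twist_apply, _root_.mul_inv_rev, Units.val_mul, Units.val_mul]
  have h2 : (GeneralLinearGroup.scalar (Fin 2) u).val * N.map e =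
      N.map e * (GeneralLinearGroup.scalar (Fin 2) u).val := by
    rw [GeneralLinearGroup.coe_scalar]
    exact (Matrix.scalar_commute u.1 (fun r => mul_comm _ _) (N.map e)).eq
  rw [mul_assoc B.val (GeneralLinearGroup.scalar (Fin 2) u).val (N.map e), h2]
  simp only [mul_assoc, Units.mul_inv_cancel_left]

theorem twist_one_one (N : Matrix (Fin 2) (Fin 2) K) : twist 1 (1 : K ≃ₐ[F] K) N = N := by
  have : N.map (1 : K ≃ₐ[F] K) = N := by ext; simp
  simp [twist_apply, this]

theorem pglMap_mk (e : K ≃ₐ[F] K) (B : GL (Fin 2) K) :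
    pglMap e (mk B) = mk (GeneralLinearGroup.map (e : K →+* K) B) := rfl

end Twist

/-! ### Triviality of `H¹(Γ, PGL(2, K))` -/

section Cocycle

variable {F K : Type*} [Field F] [Field K] [Algebra F K] {Γ : Subgroup (K ≃ₐ[F] K)}

theorem finrank_ker_trace_fin_two :
    Module.finrank K (LinearMap.ker (Matrix.traceLinearMap (Fin 2) K K)) = 3 := by
  have h := LinearMap.finrank_range_add_finrank_ker (Matrix.traceLinearMap (Fin 2) K K)
  have hs : LinearMap.range (Matrix.traceLinearMap (Fin 2) K K) = ⊤ := by
    rw [LinearMap.range_eq_top]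
    exact Matrix.trace_surjective
  rw [hs, finrank_top, Module.finrank_matrix] at h
  simp at h
  omega

theorem twist_cocycle {B : Γ → GL (Fin 2) K}
    (hB : ∀ γ δ : Γ, mk (B (γ * δ)) = mk (B γ) * pglMap (γ : K ≃ₐ[F] K) (mk (B δ)))
    (γ δ : Γ) (N : Matrix (Fin 2) (Fin 2) K) :
    twist (B (γ * δ)) (γ * δ : K ≃ₐ[F] K) N =
      twist (B γ) (γ : K ≃ₐ[F] K) (twist (B δ) (δ : K ≃ₐ[F] K) N) := by
  rw [twist_twist]
  exact DFunLike.congr_fun (twist_congr (by rw [hB, pglMap_mk, map_mul]) _) N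

theorem twist_one_of_cocycle {B : Γ → GL (Fin 2) K}
    (hB : ∀ γ δ : Γ, mk (B (γ * δ)) = mk (B γ) * pglMap (γ : K ≃ₐ[F] K) (mk (B δ)))
    (N : Matrix (Fin 2) (Fin 2) K) : twist (B 1) (1 : K ≃ₐ[F] K) N = N := by
  have h := hB 1 1
  rw [mul_one, Subgroup.coe_one, map_one, MulAut.one_apply, left_eq_mul] at h
  rw [twist_congr (h.trans (map_one mk).symm), twist_one_one]

/-- A cocycle with values in `PGL(2, K)` fixes a nonzero traceless matrix of square trace zero if
ternary forms over the fixed field are isotropic. -/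
theorem exists_isotropic_fixed [CharZero K] [Finite Γ]
    (hT : TernaryIsotropic (IntermediateField.fixedField Γ)) {B : Γ → GL (Fin 2) K}
    (hB : ∀ γ δ : Γ, mk (B (γ * δ)) = mk (B γ) * pglMap (γ : K ≃ₐ[F] K) (mk (B δ))) :
    ∃ N : Matrix (Fin 2) (Fin 2) K, N ≠ 0 ∧ N.trace = 0 ∧ (N * N).trace = 0 ∧
      ∀ γ, twist (B γ) (γ : K ≃ₐ[F] K) N = N := by
  set k := IntermediateField.fixedField Γ
  let V := LinearMap.ker (Matrix.traceLinearMap (Fin 2) K K)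
  have hV : ∀ N : V, N.1.trace = 0 := fun N => LinearMap.mem_ker.1 N.2
  let Φ : Γ → V →+ V := fun γ =>
    { toFun := fun N => ⟨twist (B γ) (γ : K ≃ₐ[F] K) N, by
        change (twist (B γ) (γ : K ≃ₐ[F] K) N.1).trace = 0
        rw [trace_twist, hV, map_zero]⟩
      map_zero' := by ext1; simp
      map_add' := fun M N => by ext1; simp }
  have hΦ : ∀ γ N, (Φ γ N).1 = twist (B γ) (γ : K ≃ₐ[F] K) N.1 := fun _ _ => rfl
  have hspan : Submodule.span K {N : V | ∀ γ, Φ γ N = N} = ⊤ := by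
    apply span_fixed_eq_top_of_semilinear
    · intro v
      ext1
      rw [hΦ]
      exact twist_one_of_cocycle hB _
    · intro γ δ v
      ext1
      rw [hΦ, hΦ, hΦ]
      exact twist_cocycle hB γ δ _
    · intro γ a v
      ext1
      rw [hΦ, Submodule.coe_smul, Submodule.coe_smul, hΦ, twist_smul]
  obtain ⟨e, he, -, hli⟩ := Submodule.exists_fun_fin_finrank_span_eq K {N : V | ∀ γ, Φ γ N = N}
  have h3 : 3 = Module.finrank K (Submodule.span K {N : V | ∀ γ, Φ γ N = N}) := by
    rw [hspan, finrank_top]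
    exact finrank_ker_trace_fin_two.symm
  generalize Module.finrank K (Submodule.span K {N : V | ∀ γ, Φ γ N = N}) = n at *
  subst h3
  have hfix : ∀ i γ, twist (B γ) (γ : K ≃ₐ[F] K) (e i).1 = (e i).1 := fun i γ => by
    rw [← hΦ, he i γ]
  -- The twisted action is multiplicative and compatible with traces, so the trace form of fixed
  -- matrices takes values in `k`.
  have hmem : ∀ i j, ((e i).1 * (e j).1).trace ∈ k := by
    intro i j
    rw [IntermediateField.mem_fixedField_iff]
    intro γ hγ
    have := trace_twist (B ⟨γ, hγ⟩) γ ((e i).1 * (e j).1)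
    rw [← this, map_mul, hfix i ⟨γ, hγ⟩, hfix j ⟨γ, hγ⟩]
  let S : Matrix (Fin 3) (Fin 3) k := Matrix.of fun i j => ⟨_, hmem i j⟩
  have hS : ∀ i j, (S i j : K) = ((e i).1 * (e j).1).trace := fun _ _ => rfl
  obtain ⟨v, hv, hQ⟩ := hT.exists_quadraticForm_eq_zero S.toQuadraticForm'
  let N : V := ∑ i, (v i : K) • e i
  have hN : N.1 = ∑ i, (v i : K) • (e i).1 := by simp [N]
  refine ⟨N.1, ?_, hV N, ?_, ?_⟩
  · intro h0
    apply hv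
    rw [Fintype.linearIndependent_iff] at hli
    ext i
    exact hli (fun i => (v i : K)) (by ext1; exact h0) i
  · have := congrArg (algebraMap k K) hQ
    simp only [Matrix.toQuadraticForm', LinearMap.BilinMap.toQuadraticMap_apply,
      Matrix.toLinearMap₂'_apply, map_sum, map_zero] at this
    rw [← this, hN, Finset.sum_mul_sum, Matrix.trace_sum]
    refine Finset.sum_congr rfl fun i _ => ?_
    rw [Matrix.trace_sum]
    refine Finset.sum_congr rfl fun j _ => ?_
    simp [← hS, mul_left_comm]
  · intro γ
    rw [hN, map_sum]
    refine Finset.sum_congr rfl fun i _ => ?_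
    rw [twist_smul, hfix]
    congr 1
    exact (IntermediateField.mem_fixedField_iff _ _).1 (v i).2 γ γ.2

/-- A nonzero nilpotent `2 × 2` matrix is conjugate to the elementary nilpotent matrix. -/
theorem exists_conj_nilpotent [CharZero K] {N : Matrix (Fin 2) (Fin 2) K} (h0 : N ≠ 0)
    (h1 : N.trace = 0) (h2 : (N * N).trace = 0) :
    ∃ P : GL (Fin 2) K, N * P.val = P.val * !![0, 1; 0, 0] := by
  rw [Matrix.trace_fin_two] at h1 h2
  simp only [Matrix.mul_apply, Fin.sum_univ_two] at h2
  have hd : N 1 1 = -N 0 0 := by linear_combination h1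
  rw [hd] at h2
  have h3 : N 0 0 * N 0 0 + N 0 1 * N 1 0 = 0 := by linear_combination h2 / 2
  -- The columns of `P` are `N v` and `v`, for a standard basis vector `v` with `N v ≠ 0`.
  by_cases hb : N 0 1 = 0
  · have ha : N 0 0 = 0 := by simpa [hb] using h3
    have hc : N 1 0 ≠ 0 := by
      intro hc
      apply h0
      ext i j
      fin_cases i <;> fin_cases j <;> simp [ha, hb, hc, hd]
    refine ⟨GeneralLinearGroup.mkOfDetNeZero !![0, 1; N 1 0, 0] (by simpa), ?_⟩
    change N * !![0, 1; N 1 0, 0] = !![0, 1; N 1 0, 0] * !![0, 1; 0, 0]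
    ext i j
    fin_cases i <;> fin_cases j <;>
      simp [Matrix.mul_apply, Fin.sum_univ_two, ha, hb, hd]
  · refine ⟨GeneralLinearGroup.mkOfDetNeZero !![N 0 1, 0; -N 0 0, 1] (by simpa), ?_⟩
    change N * !![N 0 1, 0; -N 0 0, 1] = !![N 0 1, 0; -N 0 0, 1] * !![0, 1; 0, 0]
    ext i j
    fin_cases i <;> fin_cases j <;>
      simp [Matrix.mul_apply, Fin.sum_univ_two, hd]
    · ring
    · linear_combination h3

/-- The centraliser of the elementary nilpotent matrix in `PGL(2, K)` consists of unipotents. -/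
theorem exists_mk_eq_upperRightHom {B : GL (Fin 2) K}
    (h : B.val * !![0, 1; 0, 0] = !![0, 1; 0, 0] * B.val) :
    ∃ b : K, mk B = mk (GeneralLinearGroup.upperRightHom b) := by
  have h00 := congrFun (congrFun h 0) 0
  have h01 := congrFun (congrFun h 0) 1
  simp [Matrix.mul_apply, Fin.sum_univ_two] at h00 h01
  have hd := B.det_ne_zero
  rw [Matrix.det_fin_two, ← h00, ← h01] at hd
  have ha : B 0 0 ≠ 0 := by
    intro h
    simp [h] at hd
  refine ⟨B 0 1 / B 0 0, Eq.symm (mk_eq_mk_iff.2 ⟨Units.mk0 _ ha, ?_⟩)⟩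
  ext i j
  fin_cases i <;> fin_cases j <;>
    simp [GeneralLinearGroup.upperRightHom, Matrix.mul_apply, Fin.sum_univ_two, ha, ← h00, ← h01]

theorem mk_upperRightHom_injective :
    Function.Injective fun b : K => mk (GeneralLinearGroup.upperRightHom b) := by
  intro a b h
  obtain ⟨u, hu⟩ := mk_eq_mk_iff.1 h
  have h00 := (GeneralLinearGroup.ext_iff _ _).1 hu 0 0
  have h01 := (GeneralLinearGroup.ext_iff _ _).1 hu 0 1
  simp [GeneralLinearGroup.upperRightHom, Matrix.mul_apply, Fin.sum_univ_two] at h00 h01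
  simpa [h00] using h01

theorem pglMap_upperRightHom (e : K ≃ₐ[F] K) (b : K) :
    pglMap e (mk (GeneralLinearGroup.upperRightHom b)) =
      mk (GeneralLinearGroup.upperRightHom (e b)) := by
  rw [pglMap_mk]
  congr 1
  ext i j
  fin_cases i <;> fin_cases j <;> simp [GeneralLinearGroup.upperRightHom]

/-- The average `s` of `b` over `Γ` works: sum the cocycle relation over `δ` and divide by the order
of `Γ`. -/
theorem exists_coboundary_of_additive_cocycle [CharZero K] [Finite Γ] {b : Γ → K}
    (hb : ∀ γ δ : Γ, b (γ * δ) = b γ + (γ : K ≃ₐ[F] K) (b δ)) :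
    ∃ s : K, ∀ γ : Γ, b γ = s - (γ : K ≃ₐ[F] K) s := by
  have := Fintype.ofFinite Γ
  have hn : (Fintype.card Γ : K) ≠ 0 := by exact_mod_cast Fintype.card_ne_zero
  refine ⟨(∑ δ, b δ) / Fintype.card Γ, fun γ => ?_⟩
  have h : ∑ δ, b δ = ∑ δ, b (γ * δ) := (Fintype.sum_equiv (Equiv.mulLeft γ) _ _ fun _ => rfl).symm
  simp only [hb, Finset.sum_add_distrib, Finset.sum_const, Finset.card_univ, nsmul_eq_mul,
    ← map_sum] at h
  rw [map_div₀, map_natCast]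
  field_simp
  linear_combination -h

/-- Triviality of `H¹(Γ, PGL(2, K))` if ternary forms over the fixed field are isotropic. -/
theorem exists_coboundary_of_pgl_cocycle [CharZero K] [Finite Γ]
    (hT : TernaryIsotropic (IntermediateField.fixedField Γ)) {c : Γ → PGL(2, K)}
    (hc : ∀ γ δ : Γ, c (γ * δ) = c γ * pglMap (γ : K ≃ₐ[F] K) (c δ)) :
    ∃ A : PGL(2, K), ∀ γ : Γ, c γ = A * (pglMap (γ : K ≃ₐ[F] K) A)⁻¹ := by
  choose B hB using fun γ => mk_surjective (c γ)
  obtain ⟨N, h0, h1, h2, hN⟩ := exists_isotropic_fixed hT (B := B) (by simpa only [hB] using hc)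
  obtain ⟨P, hP⟩ := exists_conj_nilpotent h0 h1 h2
  -- The cocycle fixes `N`; after the change of basis `P` it commutes with the elementary nilpotent
  -- matrix, hence is unipotent.
  have hPe : ∀ γ : Γ, ∃ b : K, mk (P⁻¹ * B γ *
      GeneralLinearGroup.map ((γ : K ≃ₐ[F] K) : K →+* K) P) =
        mk (GeneralLinearGroup.upperRightHom b) := by
    intro γ
    apply exists_mk_eq_upperRightHom
    have h3 : N.map (γ : K ≃ₐ[F] K) *
        (GeneralLinearGroup.map ((γ : K ≃ₐ[F] K) : K →+* K) P).val =
        (GeneralLinearGroup.map ((γ : K ≃ₐ[F] K) : K →+* K) P).val * !![0, 1; 0, 0] := by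
      have := congrArg (fun M => M.map ((γ : K ≃ₐ[F] K) : K →+* K)) hP
      simp only [Matrix.map_mul] at this
      refine this.trans ?_
      congr 1
      ext i j
      fin_cases i <;> fin_cases j <;> simp
    have h4 : (B γ).val * N.map (γ : K ≃ₐ[F] K) = N * (B γ).val := by
      have := hN γ
      rw [twist_apply] at this
      conv_rhs => rw [← this, mul_assoc, Units.inv_mul, mul_one]
    have h5 : (P⁻¹).val * N = !![0, 1; 0, 0] * (P⁻¹).val := by
      rw [Units.inv_mul_eq_iff_eq_mul, ← mul_assoc, ← hP, mul_assoc, Units.mul_inv, mul_one]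
    rw [Units.val_mul, Units.val_mul, mul_assoc, ← h3, ← mul_assoc, mul_assoc (P⁻¹).val, h4,
      ← mul_assoc, h5]
    simp only [mul_assoc]
  choose b hb using hPe
  have hcb : ∀ γ : Γ, c γ = mk P * mk (GeneralLinearGroup.upperRightHom (b γ)) *
      (pglMap (γ : K ≃ₐ[F] K) (mk P))⁻¹ := by
    intro γ
    rw [← hb, map_mul, map_mul, hB, map_inv, pglMap_mk]
    group
  obtain ⟨s, hs⟩ := exists_coboundary_of_additive_cocycle (b := b) (by
    intro γ δ
    apply mk_upperRightHom_injective
    have h := hc γ δ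
    simp only [hcb, Subgroup.coe_mul, map_mul, map_inv, pglMap_upperRightHom, MulAut.mul_apply] at h
    simp only [AddChar.map_add_eq_mul, map_mul]
    rw [← mul_right_inj (mk P),
      ← mul_left_inj (pglMap (γ : K ≃ₐ[F] K) (pglMap (δ : K ≃ₐ[F] K) (mk P)))⁻¹]
    rw [h]
    group)
  refine ⟨mk P * mk (GeneralLinearGroup.upperRightHom s), fun γ => ?_⟩
  rw [hcb, hs, map_mul, pglMap_upperRightHom, sub_eq_add_neg, AddChar.map_add_eq_mul,
    AddChar.map_neg_eq_inv, map_mul, map_inv, _root_.mul_inv_rev]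
  group

end Cocycle

/-! ### Groups acting on the field through a finite quotient -/

section Actions

variable {F K G : Type*} [Field F] [Field K] [Algebra F K] [CharZero K] [Group G]

/-- Triviality of `PGL(2, K)`-valued cocycles of a group acting on `K` through a finite group. -/
theorem exists_coboundary_of_finite_range (ρ : G →* (K ≃ₐ[F] K)) [Finite ρ.range]
    (hT : TernaryIsotropic (IntermediateField.fixedField ρ.range)) {c : G → PGL(2, K)}
    (hc : ∀ g h, c (g * h) = c g * pglMap (ρ g) (c h)) (h1 : ∀ g, ρ g = 1 → c g = 1) :
    ∃ A : PGL(2, K), ∀ g, c g = A * (pglMap (ρ g) A)⁻¹ := by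
  choose s hs using fun γ : ρ.range => γ.2
  -- Triviality on the kernel of `ρ` makes `c` descend to the finite group `ρ.range`.
  have hdep : ∀ g h, ρ g = ρ h → c g = c h := by
    intro g h hgh
    have h2 := hc g (g⁻¹ * h)
    rw [h1 (g⁻¹ * h) (by rw [map_mul, map_inv, hgh, inv_mul_cancel]), map_one, mul_one,
      mul_inv_cancel_left] at h2
    exact h2.symm
  obtain ⟨A, hA⟩ := exists_coboundary_of_pgl_cocycle hT (c := fun γ => c (s γ)) (by
    intro γ δ
    rw [← hs γ, ← hc]
    apply hdep
    rw [map_mul, hs, hs, hs, Subgroup.coe_mul])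
  refine ⟨A, fun g => ?_⟩
  rw [← hA ⟨ρ g, g, rfl⟩]
  exact hdep _ _ (hs ⟨ρ g, g, rfl⟩).symm

/-- A semilinear action on a plane which is by homotheties on the kernel of the action on the
field fixes a line. -/
theorem exists_fixed_line {W : Type*} [AddCommGroup W] [Module K W] (hW : Module.finrank K W = 2)
    (ρ : G →* (K ≃ₐ[F] K)) [Finite ρ.range]
    (hT : TernaryIsotropic (IntermediateField.fixedField ρ.range)) (Φ : G → W →+ W)
    (h_one : ∀ w, Φ 1 w = w) (h_mul : ∀ g h w, Φ (g * h) w = Φ g (Φ h w))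
    (h_smul : ∀ g (a : K) w, Φ g (a • w) = ρ g a • Φ g w)
    (h_ker : ∀ g, ρ g = 1 → ∃ u : K, ∀ w, Φ g w = u • w) :
    ∃ w ≠ 0, ∀ g, ∃ u : K, Φ g w = u • w := by
  have : FiniteDimensional K W := FiniteDimensional.of_finrank_pos (by omega)
  let b := Module.finBasisOfFinrankEq K W hW
  let M : G → Matrix (Fin 2) (Fin 2) K := fun g => Matrix.of fun i j => b.repr (Φ g (b j)) i
  have hM : ∀ g j, Φ g (b j) = ∑ i, M g i j • b i := fun g j => (b.sum_repr _).symm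
  have hcomb : ∀ g (P : Matrix (Fin 2) (Fin 2) K) j,
      Φ g (∑ i, P i j • b i) = ∑ i, (M g * P.map (ρ g)) i j • b i := by
    intro g P j
    simp only [map_sum, h_smul, hM, Finset.smul_sum, Matrix.mul_apply, Finset.sum_smul, smul_smul]
    rw [Finset.sum_comm]
    simp only [Matrix.map_apply, mul_comm]
  have hinj : ∀ P Q : Matrix (Fin 2) (Fin 2) K,
      (∀ j, ∑ i, P i j • b i = ∑ i, Q i j • b i) → P = Q := by
    intro P Q h
    ext i j
    have := congrArg (fun w => b.repr w i) (h j)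
    simpa only [b.repr_sum_self] using this
  have hM_mul : ∀ g h, M (g * h) = M g * (M h).map (ρ g) := by
    intro g h
    apply hinj
    intro j
    rw [← hcomb, ← hM, ← hM, h_mul]
  have hM_one : M 1 = 1 := by
    apply hinj
    intro j
    rw [← hM, h_one]
    simp [Matrix.one_apply]
  have hM_inv : ∀ g, M g * (M g⁻¹).map (ρ g) = 1 := by
    intro g
    rw [← hM_mul, mul_inv_cancel, hM_one]
  let C : G → GL (Fin 2) K := fun g =>
    ⟨M g, (M g⁻¹).map (ρ g), hM_inv g, mul_eq_one_comm.1 (hM_inv g)⟩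
  -- The matrices of the action form a cocycle in `GL(2, K)`; homotheties vanish in `PGL`, so its
  -- class is trivial on the kernel of `ρ`.
  obtain ⟨A, hA⟩ := exists_coboundary_of_finite_range ρ hT (c := fun g => mk (C g))
    (by
      intro g h
      rw [pglMap_mk, ← map_mul]
      exact congrArg mk (Units.ext (hM_mul g h)))
    (by
      intro g hg
      obtain ⟨u, hu⟩ := h_ker g hg
      have hMu : M g = Matrix.scalar (Fin 2) u := by
        apply hinj
        intro j
        rw [← hM, hu]
        simp [Matrix.diagonal_apply]
      have hu0 : u ≠ 0 := by
        rintro rfl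
        exact (C g).ne_zero (by change M g = 0; rw [hMu, map_zero])
      rw [← mk_scalar (Units.mk0 u hu0)]
      exact congrArg mk (Units.ext hMu))
  obtain ⟨P, rfl⟩ := mk_surjective A
  -- The splitting says that `M g * ρ g (P)` is a scalar multiple of `P`, so each column of `P`
  -- spans a stable line; the first is taken.
  refine ⟨∑ i, P i 0 • b i, ?_, fun g => ?_⟩
  · intro h0
    have hli := Fintype.linearIndependent_iff.1 b.linearIndependent (fun i => P i 0) h0
    apply P.det_ne_zero
    rw [Matrix.det_fin_two]
    simp [hli]
  · have h := hA g
    rw [eq_mul_inv_iff_mul_eq, pglMap_mk, ← map_mul] at h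
    obtain ⟨u, hu⟩ := mk_eq_mk_iff.1 h.symm
    refine ⟨u, ?_⟩
    rw [hcomb, Finset.smul_sum]
    refine Finset.sum_congr rfl fun i _ => ?_
    have h2 := (GeneralLinearGroup.ext_iff _ _).1 hu i 0
    have h3 : (M g * P.val.map (ρ g)) i 0 = P i 0 * u := by
      refine h2.symm.trans ?_
      simp [Matrix.mul_apply, Matrix.diagonal_apply]
    rw [h3, smul_smul, mul_comm]

end Actions

/-! ### Involutions of `PGL(2, K)` and traceless matrices -/

section Involutions

variable {K : Type*} [Field K]

/-- By Cayley–Hamilton `M² = tr(M) M - det M`; if `M²` is scalar and `tr M ≠ 0`, then `M` is scalar.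
-/
theorem trace_eq_zero_of_mk_mul_self {M : GL (Fin 2) K} (h : mk M * mk M = 1) (h1 : mk M ≠ 1) :
    M.val.trace = 0 := by
  rw [← map_mul, ← map_one mk] at h
  obtain ⟨u, hu⟩ := mk_eq_mk_iff.1 h.symm
  have h00 := (GeneralLinearGroup.ext_iff _ _).1 hu 0 0
  have h01 := (GeneralLinearGroup.ext_iff _ _).1 hu 0 1
  have h10 := (GeneralLinearGroup.ext_iff _ _).1 hu 1 0
  have h11 := (GeneralLinearGroup.ext_iff _ _).1 hu 1 1
  simp [Matrix.mul_apply, Fin.sum_univ_two] at h00 h01 h10 h11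
  rw [Matrix.trace_fin_two]
  by_contra ht
  have e01 : M 0 1 = 0 := (mul_eq_zero.1 (show (M 0 0 + M 1 1) * M 0 1 = 0 by
    linear_combination -h01)).resolve_left ht
  have e10 : M 1 0 = 0 := (mul_eq_zero.1 (show (M 0 0 + M 1 1) * M 1 0 = 0 by
    linear_combination -h10)).resolve_left ht
  have e : M 0 0 - M 1 1 = 0 := (mul_eq_zero.1 (show (M 0 0 + M 1 1) * (M 0 0 - M 1 1) = 0 by
    linear_combination h11 - h00)).resolve_left ht
  have hd := M.det_ne_zero
  rw [Matrix.det_fin_two, e01] at hd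
  have h0 : M 0 0 ≠ 0 := by
    intro h
    simp [h] at hd
  apply h1
  rw [← mk_scalar (Units.mk0 _ h0)]
  congr 1
  ext i j
  fin_cases i <;> fin_cases j <;> simp [e01, e10, sub_eq_zero.1 e]

theorem mk_mul_self_of_trace_eq_zero {M : GL (Fin 2) K} (h : M.val.trace = 0) :
    mk M * mk M = 1 := by
  rw [← map_mul, ← map_one mk]
  refine Eq.symm (mk_eq_mk_iff.2 ⟨-M.det, ?_⟩)
  rw [Matrix.trace_fin_two] at h
  have hd : M 1 1 = -M 0 0 := by linear_combination h
  ext i j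
  fin_cases i <;> fin_cases j <;>
    simp [Matrix.mul_apply, Fin.sum_univ_two, Matrix.det_fin_two, hd] <;> ring

/-- Traceless matrices orthogonal for the trace form anticommute. -/
theorem mul_eq_neg_mul_of_trace {M N : Matrix (Fin 2) (Fin 2) K} (hM : M.trace = 0)
    (hN : N.trace = 0) (h : (N * M).trace = 0) : M * N = -(N * M) := by
  rw [Matrix.trace_fin_two] at hM hN h
  simp only [Matrix.mul_apply, Fin.sum_univ_two] at h
  have hM' : M 1 1 = -M 0 0 := by linear_combination hM
  have hN' : N 1 1 = -N 0 0 := by linear_combination hN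
  rw [hM', hN'] at h
  ext i j
  fin_cases i <;> fin_cases j <;>
    simp only [Fin.zero_eta, Fin.mk_one, Matrix.mul_apply, Matrix.neg_apply, Fin.sum_univ_two, hM', hN']
  · linear_combination h
  · ring
  · ring
  · linear_combination h

/-- The traceless matrices orthogonal to `M` for the trace form. -/
def tracelessOrthogonal (M : Matrix (Fin 2) (Fin 2) K) : Submodule K (Matrix (Fin 2) (Fin 2) K) where
  carrier := {N | N.trace = 0 ∧ (N * M).trace = 0}
  zero_mem' := by simp
  add_mem' := by
    rintro _ _ ⟨h1, h2⟩ ⟨h3, h4⟩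
    simp [add_mul, h1, h2, h3, h4]
  smul_mem' := by
    rintro c _ ⟨h1, h2⟩
    simp [h1, h2]

theorem mem_tracelessOrthogonal {M N : Matrix (Fin 2) (Fin 2) K} :
    N ∈ tracelessOrthogonal M ↔ N.trace = 0 ∧ (N * M).trace = 0 := Iff.rfl

theorem trace_mul_self_ne_zero [CharZero K] {M : GL (Fin 2) K} (h : M.val.trace = 0) :
    (M.val * M.val).trace ≠ 0 := by
  have hd := M.det_ne_zero
  rw [Matrix.trace_fin_two] at h
  intro h2
  apply hd
  simp only [Matrix.trace_fin_two, Matrix.mul_apply, Fin.sum_univ_two] at h2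
  rw [Matrix.det_fin_two]
  linear_combination (M 0 0 + M 1 1) * h / 2 - h2 / 2

theorem finrank_tracelessOrthogonal [CharZero K] {M : GL (Fin 2) K} (h : M.val.trace = 0) :
    Module.finrank K (tracelessOrthogonal M.val) = 2 := by
  let f : Matrix (Fin 2) (Fin 2) K →ₗ[K] K × K :=
    (Matrix.traceLinearMap (Fin 2) K K).prod
      ((Matrix.traceLinearMap (Fin 2) K K).comp (LinearMap.mulRight K M.val))
  have hf : ∀ N, f N = (N.trace, (N * M.val).trace) := fun _ => rfl
  have hker : LinearMap.ker f = tracelessOrthogonal M.val := by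
    ext N
    rw [LinearMap.mem_ker, hf, mem_tracelessOrthogonal, Prod.mk_eq_zero]
  have hs : LinearMap.range f = ⊤ := by
    rw [LinearMap.range_eq_top]
    rintro ⟨x, y⟩
    -- The matrices `1` and `M` are orthogonal and non-isotropic for the trace form, so the
    -- coefficients decouple.
    refine ⟨(x / 2) • 1 + (y / (M.val * M.val).trace) • M.val, ?_⟩
    have := trace_mul_self_ne_zero h
    rw [hf]
    simp [add_mul, h, this]
  have hr := LinearMap.finrank_range_add_finrank_ker f
  rw [hs, finrank_top, Module.finrank_matrix, hker] at hr
  simp at hr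
  omega

/-- If `-det M` is not a square, then the nonzero traceless matrices orthogonal to `M` are
invertible. -/
theorem det_ne_zero_of_mem_tracelessOrthogonal [CharZero K] {M N : Matrix (Fin 2) (Fin 2) K}
    (hM : M.trace = 0) (hsq : ¬ IsSquare (-M.det)) (hN : N ∈ tracelessOrthogonal M) (h0 : N ≠ 0) :
    N.det ≠ 0 := by
  obtain ⟨h1, h2⟩ := mem_tracelessOrthogonal.1 hN
  intro hd
  apply hsq
  rw [Matrix.trace_fin_two] at hM h1 h2
  simp only [Matrix.mul_apply, Fin.sum_univ_two] at h2
  rw [Matrix.det_fin_two] at hd ⊢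
  have hM' : M 1 1 = -M 0 0 := by linear_combination hM
  have hN' : N 1 1 = -N 0 0 := by linear_combination h1
  rw [hM', hN'] at h2
  rw [hN'] at hd
  rw [hM']
  -- A singular `N` would be nilpotent and anticommute with `M`, so `M` would preserve the line `ker
  -- N` and have an eigenvalue, whose square is `-det M`. If `N 0 1 ≠ 0`, that line is spanned by
  -- `(N 0 1, -N 0 0)` and the witness is the eigenvalue on it.
  by_cases hb : N 0 1 = 0
  · have ha : N 0 0 = 0 := by simpa [hb] using hd
    have hc : N 1 0 ≠ 0 := by
      intro hc
      apply h0
      ext i j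
      fin_cases i <;> fin_cases j <;> simp [ha, hb, hc, hN']
    have hq : M 0 1 = 0 := by simpa [ha, hb, hc] using h2
    exact ⟨M 0 0, by rw [hq]; ring⟩
  · refine ⟨M 0 0 - N 0 0 * M 0 1 / N 0 1, ?_⟩
    field_simp
    linear_combination N 0 1 * M 0 1 * h2 + M 0 1 ^ 2 * hd

end Involutions

/-! ### Klein four-groups -/

/-- Two distinct commuting involutions generate a Klein four-group. -/
theorem exists_kleinFour {G : Type*} [Group G] {a b : G} (ha : a ≠ 1) (hb : b ≠ 1) (hab : a ≠ b)
    (haa : a * a = 1) (hbb : b * b = 1) (hc : b * a = a * b) :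
    ∃ V : Subgroup G, Nonempty (V ≃* Multiplicative (ZMod 2 × ZMod 2)) ∧
      ∀ x, x ∈ V ↔ x = 1 ∨ x = a ∨ x = b ∨ x = a * b := by
  have hsq : (a * b) * (a * b) = 1 := by rw [mul_assoc, ← mul_assoc b, hc, mul_assoc, hbb, mul_one, haa]
  have key : ∀ x, (x = 1 ∨ x = a ∨ x = b ∨ x = a * b) → x * x = 1 := by
    rintro x (rfl | rfl | rfl | rfl)
    exacts [mul_one 1, haa, hbb, hsq]
  let V : Subgroup G :=
    { carrier := {x | x = 1 ∨ x = a ∨ x = b ∨ x = a * b}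
      one_mem' := Or.inl rfl
      mul_mem' := by
        have e1 : a * (a * b) = b := by rw [← mul_assoc, haa, one_mul]
        have e2 : b * (a * b) = a := by rw [← mul_assoc, hc, mul_assoc, hbb, mul_one]
        have e3 : a * b * a = b := by rw [mul_assoc, hc, e1]
        have e4 : a * b * b = a := by rw [mul_assoc, hbb, mul_one]
        rintro x y (rfl | rfl | rfl | rfl) (rfl | rfl | rfl | rfl) <;>
          simp only [Set.mem_ofPred_eq, mul_one, one_mul, haa, hbb, hc, hsq, e1, e2, e3, e4,
            true_or, or_true]
      inv_mem' := by
        intro x hx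
        rw [inv_eq_of_mul_eq_one_left (key x hx)]
        exact hx }
  have hV : ∀ x, x ∈ V ↔ x = 1 ∨ x = a ∨ x = b ∨ x = a * b := fun _ => Iff.rfl
  have hab1 : a * b ≠ 1 := fun h => hab (by rw [eq_inv_of_mul_eq_one_left h, inv_eq_of_mul_eq_one_left hbb])
  have hcard : Nat.card V = 4 := by
    classical
    have : (V : Set G) = (({1, a, b, a * b} : Finset G) : Set G) := by
      ext x
      simp [hV]
    rw [← SetLike.coe_sort_coe, this, Nat.card_eq_card_toFinset, Finset.toFinset_coe]
    rw [Finset.card_insert_of_notMem, Finset.card_insert_of_notMem, Finset.card_pair]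
    · simpa using ha
    · simp [hab, hb]
    · simp [ha.symm, hb.symm, hab1.symm]
  have : Nontrivial V := ⟨⟨a, (hV a).2 (by simp)⟩, 1, fun h => ha (congrArg Subtype.val h)⟩
  have hexp : Monoid.exponent V = 2 := by
    rw [Monoid.exponent_eq_prime_iff Nat.prime_two]
    intro x hx
    exact orderOf_eq_prime (by ext; simpa [pow_two] using key x.1 x.2) hx
  have : IsKleinFour V := ⟨hcard, hexp⟩
  exact ⟨V, IsKleinFour.nonempty_mulEquiv, hV⟩

/-! ### Faithfulness of the action on the function field -/

namespace DeJonquieres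

theorem pglAction_injective : Function.Injective pglAction := by
  rw [injective_iff_map_eq_one]
  intro h hh
  obtain ⟨g, rfl⟩ := mk_surjective h
  rw [← inv_eq_one, ← map_inv]
  have h1 : moebius g⁻¹ = RatFunc.X := by
    rw [← subst_X]
    exact DFunLike.congr_fun hh RatFunc.X
  generalize g⁻¹ = g' at h1
  rw [moebius, div_eq_iff (denom_moebius_ne_zero g')] at h1
  have h2 : algebraMap (Polynomial ℂ) (RatFunc ℂ)
      (Polynomial.C (g' 0 0) * Polynomial.X + Polynomial.C (g' 0 1)) =
      algebraMap (Polynomial ℂ) (RatFunc ℂ)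
      (Polynomial.C (g' 1 0) * Polynomial.X ^ 2 + Polynomial.C (g' 1 1) * Polynomial.X) := by
    simp only [map_add, map_mul, map_pow, RatFunc.algebraMap_X, RatFunc.algebraMap_C]
    linear_combination h1
  have h3 := RatFunc.algebraMap_injective ℂ h2
  have c0 := congrArg (fun p => Polynomial.coeff p 0) h3
  have c1 := congrArg (fun p => Polynomial.coeff p 1) h3
  have c2 := congrArg (fun p => Polynomial.coeff p 2) h3
  simp [Polynomial.coeff_C, Polynomial.coeff_X, Polynomial.coeff_X_pow] at c0 c1 c2
  have h0 : g' 0 0 ≠ 0 := by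
    intro h
    apply det_entries_ne_zero g'
    simp [h, c0]
  rw [← mk_scalar (Units.mk0 _ h0)]
  congr 1
  ext i j
  fin_cases i <;> fin_cases j <;> simp [c0, ← c1, ← c2]

end DeJonquieres

/-! ### A second involution commuting with the group -/

theorem mk_eq_mk_iff_exists_smul {K : Type*} [Field K] {A B : GL (Fin 2) K} :
    mk A = mk B ↔ ∃ u : Kˣ, B.val = (u : K) • A.val := by
  rw [mk_eq_mk_iff]
  refine exists_congr fun u => ?_
  rw [Units.ext_iff, Units.val_mul, GeneralLinearGroup.coe_scalar, Matrix.scalar_apply,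
    ← Matrix.smul_eq_mul_diagonal, eq_comm]

theorem mk_mul_comm_of_trace {K : Type*} [Field K] {M T : GL (Fin 2) K} (hM : M.val.trace = 0)
    (hT : T.val.trace = 0) (h : (T.val * M.val).trace = 0) : mk T * mk M = mk M * mk T := by
  rw [← map_mul, ← map_mul]
  refine mk_eq_mk_iff_exists_smul.2 ⟨-1, ?_⟩
  rw [Units.val_mul, Units.val_mul, mul_eq_neg_mul_of_trace hM hT h]
  simp

theorem mk_ne_mk_of_trace {K : Type*} [Field K] [CharZero K] {M T : GL (Fin 2) K}
    (hM : M.val.trace = 0) (h : (T.val * M.val).trace = 0) : mk M ≠ mk T := by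
  intro he
  obtain ⟨u, hu⟩ := mk_eq_mk_iff_exists_smul.1 he
  rw [hu, smul_mul_assoc, Matrix.trace_smul, smul_eq_mul] at h
  exact mul_ne_zero u.ne_zero (trace_mul_self_ne_zero hM) h

theorem mk_ne_one_of_trace {K : Type*} [Field K] [CharZero K] {T : GL (Fin 2) K}
    (hT : T.val.trace = 0) : mk T ≠ 1 := by
  intro h
  rw [← map_one mk] at h
  obtain ⟨u, hu⟩ := mk_eq_mk_iff_exists_smul.1 h.symm
  rw [hu] at hT
  simp at hT

section FixedInvolution

variable {F K G : Type*} [Field F] [Field K] [Algebra F K] [Group G]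

/-- This links the two viewpoints: an involution is centralised exactly when the line of its matrix
is stable under the twisted action. -/
theorem commutes_iff_exists_twist_eq_smul {e : K ≃ₐ[F] K} {B T : GL (Fin 2) K} :
    mk B * pglMap e (mk T) = mk T * mk B ↔ ∃ u : Kˣ, twist B e T.val = (u : K) • T.val := by
  rw [pglMap_mk, ← map_mul, ← map_mul, eq_comm, mk_eq_mk_iff_exists_smul]
  refine exists_congr fun u => ?_
  rw [twist_apply, Units.mul_inv_eq_iff_eq_mul, smul_mul_assoc]
  rfl

/-- A semilinear projective action commuting with an involution `M` such that `-det M` is not a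
square, and whose part acting trivially on the field is contained in `{1, M}`, commutes with a
second involution. -/
theorem exists_orthogonal_fixed [CharZero K] (ρ : G →* (K ≃ₐ[F] K)) [Finite ρ.range]
    (hT : TernaryIsotropic (IntermediateField.fixedField ρ.range)) {B : G → GL (Fin 2) K}
    (hB : ∀ g h, mk (B (g * h)) = mk (B g) * pglMap (ρ g) (mk (B h))) {M : GL (Fin 2) K}
    (hM : M.val.trace = 0) (hfix : ∀ g, mk (B g) * pglMap (ρ g) (mk M) = mk M * mk (B g))
    (hker : ∀ g, ρ g = 1 → mk (B g) = mk 1 ∨ mk (B g) = mk M) (hsq : ¬ IsSquare (-M.val.det)) :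
    ∃ T : GL (Fin 2) K, T.val.trace = 0 ∧ (T.val * M.val).trace = 0 ∧
      ∀ g, mk (B g) * pglMap (ρ g) (mk T) = mk T * mk (B g) := by
  have hB1 : mk (B 1) = mk 1 := by
    have h := hB 1 1
    rwa [mul_one, map_one, map_one, MulAut.one_apply, left_eq_mul, ← map_one mk] at h
  let W := tracelessOrthogonal M.val
  have hW : ∀ (g : G) (N : W), twist (B g) (ρ g) N.1 ∈ W := by
    intro g N
    obtain ⟨h1, h2⟩ := mem_tracelessOrthogonal.1 N.2
    refine mem_tracelessOrthogonal.2 ⟨by rw [trace_twist, h1, map_zero], ?_⟩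
    obtain ⟨u, hu⟩ := commutes_iff_exists_twist_eq_smul.1 (hfix g)
    have h3 := trace_twist (B g) (ρ g) (N.1 * M.val)
    rw [h2, map_zero, map_mul, hu, mul_smul_comm, Matrix.trace_smul, smul_eq_mul] at h3
    exact (mul_eq_zero.1 h3).resolve_left u.ne_zero
  obtain ⟨Φ, hΦ⟩ : ∃ Φ : G → W →+ W, ∀ g N, (Φ g N).1 = twist (B g) (ρ g) N.1 :=
    ⟨fun g =>
      { toFun := fun N => ⟨twist (B g) (ρ g) N.1, hW g N⟩
        map_zero' := by ext1; simp
        map_add' := fun N N' => by ext1; simp }, fun _ _ => rfl⟩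
  have hrank : Module.finrank K W = 2 := finrank_tracelessOrthogonal hM
  obtain ⟨N, hN0, hN⟩ := exists_fixed_line (W := W) hrank ρ hT Φ
    (by
      intro N
      ext1
      rw [hΦ, map_one, twist_congr hB1, twist_one_one])
    (by
      intro g h N
      ext1
      rw [hΦ, hΦ, hΦ, twist_twist, ← map_mul]
      refine DFunLike.congr_fun (twist_congr ?_ _) _
      rw [hB, map_mul, ← pglMap_mk])
    (by
      intro g a N
      ext1
      rw [hΦ, Submodule.coe_smul, Submodule.coe_smul, hΦ, twist_smul])
    (by
      intro g hg
      rcases hker g hg with h | h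
      · refine ⟨1, fun N => ?_⟩
        ext1
        rw [hΦ, hg, one_smul, twist_congr h, twist_one_one]
      -- Elements of `W` anticommute with `M`, so conjugation by `M` is `-1` on `W`.
      · refine ⟨-1, fun N => ?_⟩
        obtain ⟨h1, h2⟩ := mem_tracelessOrthogonal.1 N.2
        have hmap : N.1.map (1 : K ≃ₐ[F] K) = N.1 := by ext; simp
        ext1
        rw [hΦ, hg, twist_congr h, twist_apply, hmap,
          mul_eq_neg_mul_of_trace hM h1 h2, neg_mul, mul_assoc, Units.mul_inv, mul_one,
          neg_one_smul, Submodule.coe_neg])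
  obtain ⟨hNt, hNM⟩ := mem_tracelessOrthogonal.1 N.2
  have hNd : N.1.det ≠ 0 :=
    det_ne_zero_of_mem_tracelessOrthogonal hM hsq N.2 (fun h => hN0 (Subtype.ext h))
  obtain ⟨T, hTN⟩ : ∃ T : GL (Fin 2) K, T.val = N.1 :=
    ⟨GeneralLinearGroup.mkOfDetNeZero N.1 hNd, rfl⟩
  refine ⟨T, by rw [hTN, hNt], by rw [hTN, hNM], fun g => ?_⟩
  rw [commutes_iff_exists_twist_eq_smul, hTN]
  obtain ⟨u, hu⟩ := hN g
  have h1 : twist (B g) (ρ g) N.1 = u • N.1 := by rw [← hΦ, hu, Submodule.coe_smul]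
  have hu0 : u ≠ 0 := by
    rintro rfl
    rw [zero_smul, map_eq_zero_iff _ (twist_injective (B g) (ρ g))] at h1
    exact hN0 (Subtype.ext h1)
  exact ⟨Units.mk0 u hu0, h1⟩

end FixedInvolution

/-! ### Application to the de Jonquières group -/

namespace DeJonquieres

/-- The action on `ℂ(x)` of a subgroup of the de Jonquières group. -/
noncomputable def fieldAction (G : Subgroup DJo) : G →* (RatFunc ℂ ≃ₐ[ℂ] RatFunc ℂ) :=
  pglAction.comp (toBase.comp G.subtype)

theorem finite_range_fieldAction {G : Subgroup DJo} (hH : Finite (baseImage G)) :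
    Finite (fieldAction G).range := by
  have : (fieldAction G).range = (baseImage G).map pglAction := by
    rw [fieldAction, MonoidHom.range_comp, MonoidHom.range_comp, Subgroup.range_subtype]
    rfl
  rw [this]
  exact Set.Finite.image _ (Set.toFinite (baseImage G : Set PGL(2, ℂ)))

theorem right_eq_one_of_fieldAction_eq_one {G : Subgroup DJo} {g : G} (h : fieldAction G g = 1) :
    g.1.right = 1 :=
  (injective_iff_map_eq_one pglAction).1 pglAction_injective _ h

theorem mem_fibreKernel {G : Subgroup DJo} {g : DJo} :
    g ∈ fibreKernel G ↔ g ∈ G ∧ g.right = 1 := Iff.rfl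

theorem mul_inFibre (g : DJo) (A : PGL(2, RatFunc ℂ)) :
    g * inFibre A = inFibre (g.left * pglMap (pglAction g.right) A * g.left⁻¹) * g := by
  ext1
  · simp only [SemidirectProduct.mul_left, SemidirectProduct.left_inl, SemidirectProduct.right_inl,
      map_one, MulAut.one_apply, inv_mul_cancel_right]
    rfl
  · simp

/-- A subgroup of the de Jonquières group whose base action is faithful and has finite image is
conjugate to its image. -/
theorem exists_conj_eq_of_fibreKernel_eq_bot (G : Subgroup DJo) (hH : Finite (baseImage G))
    (hG : fibreKernel G = ⊥) :
    ∃ g : DJo, G.map (MulAut.conj g).toMonoidHom = (baseImage G).map inBase := by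
  have := finite_range_fieldAction hH
  obtain ⟨A, hA⟩ := exists_coboundary_of_finite_range (fieldAction G)
    (IntermediateField.ternaryIsotropic _) (c := fun g => g.1.left) (fun _ _ => rfl) (by
      intro g hg
      have hmem : g.1 ∈ fibreKernel G :=
        mem_fibreKernel.2 ⟨g.2, right_eq_one_of_fieldAction_eq_one hg⟩
      rw [hG, Subgroup.mem_bot] at hmem
      rw [hmem, SemidirectProduct.one_left])
  have key : ∀ g ∈ G, inFibre A⁻¹ * g * (inFibre A⁻¹)⁻¹ = inBase (toBase g) := by
    intro g hg
    have h := hA ⟨g, hg⟩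
    change g.left = _ at h
    rw [← map_inv, inv_inv, mul_assoc, mul_inFibre, ← mul_assoc, ← map_mul]
    ext1
    · change A⁻¹ * (g.left * pglMap (fieldAction G ⟨g, hg⟩) A * g.left⁻¹) * _ = 1
      simp only [SemidirectProduct.right_inl, map_one, MulAut.one_apply]
      rw [h]
      group
    · simp
  refine ⟨inFibre A⁻¹, ?_⟩
  rw [baseImage, Subgroup.map_map]
  ext x
  simp only [Subgroup.mem_map]
  refine exists_congr fun g => and_congr_right fun hg => ?_
  have := key g hg
  change _ * _ * _ = x ↔ inBase (toBase g) = x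
  rw [this]

/-- Since `-1 = i²` is a square, nontriviality of the determinant says equally that `-det M` is not
a square. -/
theorem pglDet_eq_one_of_isSquare {M : GL (Fin 2) (RatFunc ℂ)} (h : IsSquare (-M.val.det)) :
    pglDet (RatFunc ℂ) (mk M) = 1 := by
  obtain ⟨s, hs⟩ := h
  have hd : M.val.det = (RatFunc.C Complex.I * s) ^ 2 := by
    have hI : (RatFunc.C Complex.I : RatFunc ℂ) ^ 2 = -1 := by
      rw [← map_pow, Complex.I_sq, map_neg, map_one]
    rw [mul_pow, hI]
    linear_combination -hs
  have hne := M.det_ne_zero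
  rw [hd] at hne
  refine (QuotientGroup.eq_one_iff _).2 ⟨Units.mk0 _ (pow_ne_zero_iff (by norm_num) |>.1 hne), ?_⟩
  ext1
  exact hd.symm

/-- If `G` acts on the base through a finite group and the kernel of this action is generated by
an involution of nontrivial determinant, then `G` centralises a Klein four-group of fibre
automorphisms containing this kernel. -/
theorem exists_kleinFour_normalized (G : Subgroup DJo) (hH : Finite (baseImage G))
    (σ : PGL(2, RatFunc ℂ)) (hσ : orderOf σ = 2) (hdet : pglDet (RatFunc ℂ) σ ≠ 1)
    (hG : fibreKernel G = Subgroup.zpowers (inFibre σ)) :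
    ∃ V : Subgroup PGL(2, RatFunc ℂ),
      Nonempty (V ≃* Multiplicative (ZMod 2 × ZMod 2)) ∧
      fibreKernel G ≤ V.map inFibre ∧
      G ≤ Subgroup.normalizer (V.map inFibre) := by
  have := finite_range_fieldAction hH
  have hσ1 : σ ≠ 1 := by
    rintro rfl
    simp at hσ
  have hσσ : σ * σ = 1 := by
    rw [← pow_two]
    exact orderOf_dvd_iff_pow_eq_one.1 hσ.dvd
  have hker : ∀ x ∈ fibreKernel G, x = 1 ∨ x = inFibre σ := by
    intro x hx
    rw [hG, Subgroup.mem_zpowers_iff] at hx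
    obtain ⟨n, rfl⟩ := hx
    rw [← map_zpow]
    rcases Int.even_or_odd' n with ⟨m, rfl | rfl⟩
    · left
      rw [_root_.zpow_mul, zpow_ofNat, pow_two, hσσ, _root_.one_zpow, map_one]
    · right
      rw [_root_.zpow_add, _root_.zpow_mul, zpow_ofNat, pow_two, hσσ, _root_.one_zpow, one_mul, zpow_one]
  have hσG : inFibre σ ∈ fibreKernel G := hG ▸ Subgroup.mem_zpowers _
  -- `G'` is normal in `G` and `σ` is its only nontrivial element, so `G` centralises `σ`.
  have hconj : ∀ g ∈ G, g.left * pglMap (pglAction g.right) σ = σ * g.left := by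
    intro g hg
    have hmem : inFibre (g.left * pglMap (pglAction g.right) σ * g.left⁻¹) ∈ fibreKernel G := by
      rw [mem_fibreKernel]
      refine ⟨?_, rfl⟩
      rw [eq_mul_inv_of_mul_eq (mul_inFibre g σ).symm]
      exact G.mul_mem (G.mul_mem hg (mem_fibreKernel.1 hσG).1) (G.inv_mem hg)
    rcases hker _ hmem with h | h
    · rw [← map_one inFibre] at h
      have h1 := SemidirectProduct.inl_injective h
      rw [conj_eq_one_iff] at h1
      exact absurd ((map_eq_one_iff _ (MulEquiv.injective _)).1 h1) hσ1
    · exact mul_inv_eq_iff_eq_mul.1 (SemidirectProduct.inl_injective h)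
  obtain ⟨M, rfl⟩ := mk_surjective σ
  have hM := trace_eq_zero_of_mk_mul_self hσσ hσ1
  choose B hB using fun g : G => mk_surjective g.1.left
  obtain ⟨T, hTt, hTM, hTfix⟩ := exists_orthogonal_fixed (fieldAction G)
    (IntermediateField.ternaryIsotropic _) (B := B) (fun g h => by rw [hB, hB, hB]; rfl) hM
    (fun g => by rw [hB]; exact hconj g g.2)
    (fun g hg => by
      rw [hB, map_one]
      have hmem : g.1 ∈ fibreKernel G :=
        mem_fibreKernel.2 ⟨g.2, right_eq_one_of_fieldAction_eq_one hg⟩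
      exact (hker _ hmem).imp (congrArg SemidirectProduct.left) (congrArg SemidirectProduct.left))
    (fun h => hdet (pglDet_eq_one_of_isSquare h))
  have hconjT : ∀ g ∈ G, g.left * pglMap (pglAction g.right) (mk T) = mk T * g.left := by
    intro g hg
    have h := hTfix ⟨g, hg⟩
    rwa [hB] at h
  obtain ⟨V, hVe, hV⟩ := exists_kleinFour hσ1 (mk_ne_one_of_trace hTt) (mk_ne_mk_of_trace hM hTM)
    hσσ (mk_mul_self_of_trace_eq_zero hTt) (mk_mul_comm_of_trace hM hTt hTM)
  have hcomm : ∀ g ∈ G, ∀ x ∈ V, g * inFibre x = inFibre x * g := by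
    intro g hg x hx
    rw [mul_inFibre]
    congr 2
    rw [mul_inv_eq_iff_eq_mul]
    have e1 := hconj g hg
    have e2 := hconjT g hg
    rcases (hV x).1 hx with rfl | rfl | rfl | rfl
    · simp
    · exact e1
    · exact e2
    · rw [map_mul, ← mul_assoc, e1, mul_assoc, e2, mul_assoc]
  refine ⟨V, hVe, ?_, Subgroup.le_normalizer_iff.2 ?_⟩
  · rw [hG, Subgroup.zpowers_le]
    exact ⟨mk M, (hV _).2 (by simp), rfl⟩
  · rintro g hg _ ⟨x, hx, rfl⟩
    rw [hcomm g hg x hx, mul_inv_cancel_right]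
    exact ⟨x, hx, rfl⟩

end DeJonquieres

end Cocycles

open DeJonquieres in
theorem mainTheorem5 (G : Subgroup DJo) (hH : Finite (baseImage G)) :
    (fibreKernel G = ⊥ →
      ∃ g : DJo, G.map (MulAut.conj g).toMonoidHom = (baseImage G).map inBase) ∧
    (∀ σ : PGL(2, RatFunc ℂ), orderOf σ = 2 → pglDet (RatFunc ℂ) σ ≠ 1 →
      fibreKernel G = Subgroup.zpowers (inFibre σ) →
      ∃ V : Subgroup PGL(2, RatFunc ℂ),
        Nonempty (V ≃* Multiplicative (ZMod 2 × ZMod 2)) ∧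
        fibreKernel G ≤ V.map inFibre ∧
        G ≤ Subgroup.normalizer (V.map inFibre)) :=
  ⟨exists_conj_eq_of_fibreKernel_eq_bot G hH, exists_kleinFour_normalized G hH⟩
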